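/- Let $E$ be an elliptic curve over $\mathbb{Q}$ given by a Weierstrass equation $y^2+a_1xy+a_3y=x^3+a_2x^2+a_4x+a_6$, let $N$ be its conductor, and let $f$ be the normalized newform of weight $2$ on $\Gamma_0(N)$ associated to $E$. For $\tau\in\mathcal{H}^*=\mathcal{H}\cup\mathbb{Q}\cup\{i\infty\}$ put $$\gamma(\tau)=\int_{i\infty}^{\tau}2\pi i f(z)\,dz .$$ Assume that $E$ is optimal with Manin constant $1$, that is, if $L$ denotes the period lattice of $E$ with respect to the differential $dx/(2y+a_1x+a_3)$, then $\gamma$ induces a map $X_0(N)\to\mathbb{C}/L$, and every map $X_0(N)\to\mathbb{C}/L'$ induced by a nonzero multiple of $\gamma$, for a lattice $L'\subset\mathbb{C}$, factors through it. Let $\wp$ be the Weierstrass function of $L$, let $b_2=a_1^2+4a_2$, and define $x:\mathcal{H}^*\to\mathbb{C}\cup\{\infty\}$ by $$x(\tau)=\wp(\gamma(\tau))-\frac{b_2}{12},$$ so that $x(\tau)=\infty$ exactly when $\gamma(\tau)\in L$. Suppose that $N=4m$ for a positive integer $m$ and that $\gamma\left(\frac{2}{N}\right)\in L$. Then $$x\left(\frac{\tau}{2m\tau+1}\right)=x(\tau)\qquad\text{for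 all }\tau\in\mathcal{H}^*,$$ where at the cusps $\tau\mapsto\tau/(2m\tau+1)$ is the Möbius transformation of $\mathbb{Q}\cup\{i\infty\}$, so that $i\infty\mapsto\frac{1}{2m}$ and $-\frac{1}{2m}\mapsto i\infty$. -/

import Mathlib

open UpperHalfPlane MeasureTheory CongruenceSubgroup
open scoped MatrixGroups ModularForm

noncomputable section

namespace ModularParam

/-! ### Newforms of weight two on `Γ₀(N)` -/

/-- The function `τ ↦ f (d τ)` on the upper half-plane, for a positive integer `d`. -/
def dilate (d : ℕ) (f : ℍ → ℂ) (τ : ℍ) : ℂ :=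
  f (ofComplex ((d : ℂ) * τ))

/-- The Petersson product of weight two at level `Γ₀(N)`: the integral of
`conj (f τ) * g τ * (im τ) ^ 2` against `dx dy / y ^ 2` over the fundamental domain
`⋃ M 𝒟` of `Γ₀(N)`, where `𝒟` is the standard fundamental domain of `SL(2, ℤ)` and `M` runs
through representatives of the (finitely many) right cosets `Γ₀(N) M` in `SL(2, ℤ)`.
(The inverses of representatives of left cosets represent the right cosets.) -/
def peterssonInner (N : ℕ) (f g : ℍ → ℂ) : ℂ :=
  ∑ᶠ c : SL(2, ℤ) ⧸ Gamma0 N, ∫ τ in ModularGroup.fd, petersson 2 f g ((c.out)⁻¹ • τ)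

/-- `f` lies in the new subspace of `S₂(Γ₀(N))`: it is orthogonal to all oldforms `g (d τ)` with
`g ∈ S₂(Γ₀(M))`, `M` a proper divisor of `N` and `d` a divisor of `N / M`. -/
def IsNew {N : ℕ} (f : CuspForm (Gamma0 N) 2) : Prop :=
  ∀ M d : ℕ, M ≠ N → d * M ∣ N → ∀ g : CuspForm (Gamma0 M) 2,
    peterssonInner N f (dilate d g) = 0

/-- The Hecke operator `T_p` (for `p ∤ N`), respectively `U_p` (for `p ∣ N`), in weight two
and level `Γ₀(N)`. -/
def hecke (N p : ℕ) (f : ℍ → ℂ) (τ : ℍ) : ℂ :=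
  (1 / (p : ℂ)) * ∑ b ∈ Finset.range p, f (ofComplex (((τ : ℂ) + b) / p)) +
    if p ∣ N then 0 else (p : ℂ) * dilate p f τ

/-- A normalized newform of weight two on `Γ₀(N)`: a cusp form in the new subspace which is an
eigenform of all Hecke operators and has first Fourier coefficient `1`. -/
structure IsNewform {N : ℕ} (f : CuspForm (Gamma0 N) 2) : Prop where
  new : IsNew f
  eigen : ∀ p : ℕ, p.Prime → ∃ a : ℂ, ∀ τ : ℍ, hecke N p f τ = a * f τ
  normalized : (qExpansion 1 f).coeff 1 = 1

/-- `f = ∑ aₙ qⁿ` is associated to the elliptic curve `W` over `ℚ`: the `aₙ` are the coefficients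
of the Hasse-Weil `L`-function of `W`. -/
def IsAssociated {N : ℕ} (f : CuspForm (Gamma0 N) 2) (W : WeierstrassCurve ℚ) : Prop :=
  ∀ n : ℕ, (qExpansion 1 f).coeff n = (W.LFunction n : ℂ)

/-! ### The extended upper half-plane and the Eichler integral -/

/-- The extended upper half-plane `ℍ ∪ ℚ ∪ {i∞}`. -/
inductive HStar : Type
  | point (τ : ℍ) : HStar
  | cusp (c : OnePoint ℚ) : HStar

/-- The action of `SL(2, ℤ)` on the extended upper half-plane by Möbius transformations. -/
def HStar.moebius (g : SL(2, ℤ)) : HStar → HStar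
  | .point τ => .point (g • τ)
  | .cusp c => .cusp (Matrix.SpecialLinearGroup.mapGL ℚ g • c)

/-- The integral of `2πi f(z) dz` from `i∞` down to `z₀` along the vertical half-line
`z₀ + i t`, `t > 0`. -/
def verticalIntegral (f : ℍ → ℂ) (z₀ : ℂ) : ℂ :=
  -∫ t in Set.Ioi (0 : ℝ),
    2 * Real.pi * Complex.I * f (ofComplex (z₀ + t * Complex.I)) * Complex.I

/-- The Eichler integral `γ(τ) = ∫_{i∞}^τ 2πi f(z) dz`, for `τ` in the extended upper
half-plane. -/
def eichler (f : ℍ → ℂ) : HStar → ℂ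
  | .point τ => verticalIntegral f τ
  | .cusp none => 0
  | .cusp (some r) => verticalIntegral f (r : ℂ)

/-! ### Period lattices and modular parametrizations -/

/-- `L` is (a basis of) the period lattice of the elliptic curve `W` over `ℚ`, with respect to the
invariant differential `dx / (2y + a₁x + a₃)`: the map
`z ↦ (℘(z) - b₂/12, (℘'(z) - a₁ (℘(z) - b₂/12) - a₃)/2)`, under which this differential pulls back
to `dz`, sends `ℂ / L` to `W`. -/
def IsPeriodLattice (W : WeierstrassCurve ℚ) (L : PeriodPair) : Prop :=
  ∀ z : ℂ, z ∉ L.lattice →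
    (W.map (algebraMap ℚ ℂ)).toAffine.Equation
      (L.weierstrassP z - (W.b₂ : ℂ) / 12)
      ((L.derivWeierstrassP z - (W.a₁ : ℂ) * (L.weierstrassP z - (W.b₂ : ℂ) / 12)
        - (W.a₃ : ℂ)) / 2)

/-- The map `τ ↦ c γ(τ)` induces a nonconstant map `X₀(N) → ℂ / L` (which sends the cusp `i∞` to
the origin and pulls `dz` back to `c · 2πi f(τ) dτ`). -/
def IsParametrization {N : ℕ} (f : CuspForm (Gamma0 N) 2) (L : PeriodPair) (c : ℂ) : Prop :=
  c ≠ 0 ∧ ∀ M ∈ Gamma0 N, ∀ τ : ℍ,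
    c * (eichler f (.point (M • τ)) - eichler f (.point τ)) ∈ L.lattice

/-- The parametrization `c γ : X₀(N) → ℂ / L` is optimal: every parametrization
`c' γ : X₀(N) → ℂ / L'` factors through it (by multiplication with `c' / c`). -/
def IsOptimal {N : ℕ} (f : CuspForm (Gamma0 N) 2) (L : PeriodPair) (c : ℂ) : Prop :=
  IsParametrization f L c ∧
    ∀ (L' : PeriodPair) (c' : ℂ), IsParametrization f L' c' →
      ∀ l ∈ L.lattice, c' / c * l ∈ L'.lattice

open Classical in
/-- The function `x(τ) = ℘(γ(τ)) - b₂/12` on the extended upper half-plane, with values in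
`ℂ ∪ {∞}`; the value is `∞` exactly at the poles of `℘ ∘ γ`. -/
def xCoord (W : WeierstrassCurve ℚ) (L : PeriodPair) (f : ℍ → ℂ) (τ : HStar) : OnePoint ℂ :=
  if eichler f τ ∈ L.lattice then OnePoint.infty
  else ((L.weierstrassP (eichler f τ) - (W.b₂ : ℂ) / 12 : ℂ) : OnePoint ℂ)

/-- The matrix with rows `(1, 0)` and `(2m, 1)`, which acts by `τ ↦ τ / (2mτ + 1)`. -/
def wMat (m : ℕ) : SL(2, ℤ) :=
  ⟨!![1, 0; 2 * (m : ℤ), 1], by simp [Matrix.det_fin_two]⟩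

theorem coe_wMat_smul (m : ℕ) (τ : ℍ) :
    ((wMat m • τ : ℍ) : ℂ) = (τ : ℂ) / (2 * m * (τ : ℂ) + 1) := by
  rw [UpperHalfPlane.specialLinearGroup_apply]
  simp [wMat]

theorem mapGL_wMat_apply (m : ℕ) (i j : Fin 2) :
    (Matrix.SpecialLinearGroup.mapGL ℚ (wMat m)) i j =
      (((!![1, 0; 2 * (m : ℤ), 1] : Matrix (Fin 2) (Fin 2) ℤ) i j : ℤ) : ℚ) :=
  rfl

theorem wMat_smul_cusp (m : ℕ) (r : ℚ) :
    HStar.moebius (wMat m) (.cusp (r : OnePoint ℚ)) =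
      .cusp (if 2 * m * r + 1 = 0 then OnePoint.infty
        else ((r / (2 * m * r + 1) : ℚ) : OnePoint ℚ)) := by
  simp only [HStar.moebius, OnePoint.smul_some_eq_ite, mapGL_wMat_apply]
  simp

theorem wMat_smul_infty (m : ℕ) (hm : m ≠ 0) :
    HStar.moebius (wMat m) (.cusp OnePoint.infty) =
      .cusp ((1 / (2 * m) : ℚ) : OnePoint ℚ) := by
  simp only [HStar.moebius, OnePoint.smul_infty_eq_ite, mapGL_wMat_apply]
  simp [hm]

end ModularParam

end

noncomputable section

namespace ModularParam

open Filter Topology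
open scoped Manifold

/-! ### The invariant measure on the upper half-plane -/

/-! Write `w` for `wMat m`. It lies in `Γ₀(2m)`, normalises `Γ₀(4m)`, and together with `1`
represents the two cosets of `Γ₀(4m)` in `Γ₀(2m)`. Hence `φ = f + f|w` is the trace of `f` to level
`2m`, an oldform at level `4m`, and newness gives `⟨f, φ⟩ = 0`. Since `φ|w = φ` and `w` normalises
`Γ₀(4m)`, also `⟨f|w, φ⟩ = 0`. So `⟨φ, φ⟩ = 0`, and `φ = 0`, that is `f|w = -f`
(`slash_wMat_of_isNew`). In weight two this says that `γ(wτ) + γ(τ)` has derivative zero. The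
constant is `γ(w∞) = γ(1/(2m)) = γ(2/N)`, because `γ(i∞) = 0`; the relation passes to the cusps
because `γ` has limits there (`tendsto_eichler_smul`, `eichler_moebius_of_slash_eq_neg`). By
hypothesis the constant lies in `L`, so evenness and periodicity of `℘` finish the proof. -/

instance : (volume : Measure ℍ).IsOpenPosMeasure := by
  have h1 : (volume.comap UpperHalfPlane.coe : Measure ℍ).IsOpenPosMeasure := by
    refine ⟨fun U hU hne ↦ ?_⟩
    rw [measurableEmbedding_coe.comap_apply]
    exact ((isOpenEmbedding_coe.isOpenMap U hU).measure_pos _ (hne.image _)).ne'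
  refine (withDensity_absolutelyContinuous' ?_ ?_ :
    (volume.comap UpperHalfPlane.coe : Measure ℍ) ≪ volume).isOpenPosMeasure
  · refine Continuous.aemeasurable ?_
    refine ENNReal.continuous_coe.comp (.pow (.div₀ continuous_const ?_ ?_) _)
    · exact continuous_im.subtype_mk _
    · exact fun x ↦ NNReal.ne_iff.mp x.im_ne_zero
  · refine .of_forall fun x ↦ ?_
    simp [← NNReal.coe_eq_zero, x.im_ne_zero]

/-- The standard fundamental domain of `SL(2, ℤ)` has finite hyperbolic area. -/
lemma volume_fd_lt_top : volume ModularGroup.fd < ⊤ := by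
  rw [volume_eq_lintegral]
  let S : Set (ℝ × ℝ) := Set.Icc (-1 / 2) (1 / 2) ×ˢ Set.Ioi (1 / 2 : ℝ)
  -- On the fundamental domain `|x| ≤ 1/2` and `4y² ≥ 3`, so it sits in a half-strip `y > 1/2`, over
  -- which `dx dy / y²` is integrable.
  have hsub : UpperHalfPlane.coe '' ModularGroup.fd ⊆ Complex.measurableEquivRealProd ⁻¹' S := by
    rintro _ ⟨τ, hτ, rfl⟩
    have h1 := ModularGroup.three_le_four_mul_im_sq_of_mem_fd hτ
    have h2 := abs_le.mp hτ.2
    have h3 := τ.im_pos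
    have h4 : -1 / 2 ≤ τ.re ∧ τ.re ≤ 1 / 2 := ⟨by linarith [h2.1], h2.2⟩
    have h5 : 1 / 2 < τ.im := by nlinarith
    exact ⟨h4, h5⟩
  refine (lintegral_mono_set hsub).trans_lt ?_
  have hcv := Complex.volume_preserving_equiv_real_prod.setLIntegral_comp_preimage_emb
    Complex.measurableEquivRealProd.measurableEmbedding
    (fun p : ℝ × ℝ ↦ (((1 / ‖p.2‖₊) ^ 2 : NNReal) : ENNReal)) S
  simp only [Complex.measurableEquivRealProd_apply] at hcv
  rw [hcv]
  have hint : IntegrableOn (fun p : ℝ × ℝ ↦ (1 : ℝ) * p.2 ^ (-2 : ℝ)) S := by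
    have h1 : IntegrableOn (fun _ : ℝ ↦ (1 : ℝ)) (Set.Icc (-1 / 2) (1 / 2)) :=
      integrableOn_const (by simp)
    have h2 := integrableOn_Ioi_rpow_of_lt (a := -2) (by norm_num) (c := 1 / 2) (by norm_num)
    have := Integrable.mul_prod h1 h2
    rwa [Measure.prod_restrict] at this
  refine lt_of_eq_of_lt ?_ hint.2
  refine setLIntegral_congr_fun (measurableSet_Icc.prod measurableSet_Ioi) fun p hp ↦ ?_
  have hp2 : 0 < p.2 := lt_trans (by norm_num) hp.2
  rw [← ofReal_norm, ← ENNReal.ofReal_coe_nnreal]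
  congr 1
  simp only [one_mul]
  rw [Real.norm_of_nonneg (by positivity), Real.rpow_neg hp2.le]
  simp [abs_of_pos hp2]

/-! ### Cusp forms for congruence subgroups -/

/-- A cusp form from a holomorphic slash-invariant function all of whose translates under
`SL(2, ℤ)` vanish at infinity. -/
def cuspFormOfSlash {k : ℤ} (Γ : Subgroup SL(2, ℤ)) [Γ.FiniteIndex] (φ : ℍ → ℂ)
    (hφ : ∀ g ∈ Γ, φ ∣[k] g = φ) (hol : MDiff φ)
    (hzero : ∀ g : SL(2, ℤ), IsZeroAtImInfty (φ ∣[k] g)) : CuspForm Γ k where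
  toFun := φ
  slash_action_eq' := by
    rintro _ ⟨g, hg, rfl⟩
    exact hφ g hg
  holo' := hol
  zero_at_cusps' {c} hc := by
    have : (Γ : Subgroup (GL (Fin 2) ℝ)).IsArithmetic :=
      Subgroup.isArithmetic_iff_finiteIndex.mpr inferInstance
    rw [Subgroup.IsArithmetic.isCusp_iff_isCusp_SL2Z] at hc
    exact (OnePoint.isZeroAt_iff_forall_SL2Z hc).mpr fun g _ ↦ hzero g

lemma coe_cuspFormOfSlash {k : ℤ} (Γ : Subgroup SL(2, ℤ)) [Γ.FiniteIndex] (φ : ℍ → ℂ)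
    (hφ : ∀ g ∈ Γ, φ ∣[k] g = φ) (hol : MDiff φ)
    (hzero : ∀ g : SL(2, ℤ), IsZeroAtImInfty (φ ∣[k] g)) :
    ⇑(cuspFormOfSlash Γ φ hφ hol hzero) = φ := rfl

lemma mem_Gamma0_iff_dvd {N : ℕ} {g : SL(2, ℤ)} : g ∈ Gamma0 N ↔ (N : ℤ) ∣ g 1 0 := by
  rw [Gamma0_mem, ZMod.intCast_zmod_eq_zero_iff_dvd]

lemma slash_eq_of_mem {N : ℕ} {k : ℤ} (f : CuspForm (Gamma0 N) k) {g : SL(2, ℤ)}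
    (hg : g ∈ Gamma0 N) : (f : ℍ → ℂ) ∣[k] g = f :=
  SlashInvariantFormClass.slash_action_eq f _ ⟨g, hg, rfl⟩

/-! ### The element `wMat m` and the groups `Γ₀(4m)`, `Γ₀(2m)` -/

lemma coe_wMat (m : ℕ) : (wMat m : Matrix (Fin 2) (Fin 2) ℤ) = !![1, 0; 2 * (m : ℤ), 1] := rfl

lemma wMat_mul_apply_one_zero (m : ℕ) (g : SL(2, ℤ)) :
    (wMat m * g) 1 0 = 2 * m * g 0 0 + g 1 0 := by
  rw [Matrix.SpecialLinearGroup.coe_mul, coe_wMat]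
  simp [Matrix.mul_apply]

lemma mul_wMat_inv_apply_one_zero (m : ℕ) (g : SL(2, ℤ)) :
    (g * (wMat m)⁻¹) 1 0 = g 1 0 - 2 * m * g 1 1 := by
  rw [Matrix.SpecialLinearGroup.coe_mul, Matrix.SpecialLinearGroup.coe_inv, coe_wMat,
    Matrix.adjugate_fin_two_of]
  simp [Matrix.mul_apply]
  ring

lemma odd_of_mem_Gamma0 {m : ℕ} {g : SL(2, ℤ)} (hg : g ∈ Gamma0 (2 * m)) :
    Odd (g 0 0) ∧ Odd (g 1 1) := by
  obtain ⟨k, hk⟩ := mem_Gamma0_iff_dvd.mp hg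
  have hdet := g.det_coe
  rw [Matrix.det_fin_two] at hdet
  rw [hk] at hdet
  have : Odd (g 0 0 * g 1 1) := ⟨g 0 1 * (m * k), by push_cast at hdet; linarith⟩
  exact Int.odd_mul.mp this

lemma Gamma0_four_le_two (m : ℕ) : Gamma0 (4 * m) ≤ Gamma0 (2 * m) := by
  intro g hg
  rw [mem_Gamma0_iff_dvd] at hg ⊢
  refine dvd_trans ⟨2, ?_⟩ hg
  push_cast
  ring

/-- The lower left entry of `g` is `2mk`, and the case depends on the parity of `k`. Multiplying by
`w` or `w⁻¹` changes `k` by a diagonal entry of `g`, which is odd. -/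
lemma mem_Gamma0_four_or (m : ℕ) {g : SL(2, ℤ)} (hg : g ∈ Gamma0 (2 * m)) :
    g ∈ Gamma0 (4 * m) ∨ g * (wMat m)⁻¹ ∈ Gamma0 (4 * m) ∧ wMat m * g ∈ Gamma0 (4 * m) := by
  obtain ⟨⟨a, ha⟩, ⟨d, hd⟩⟩ := odd_of_mem_Gamma0 hg
  obtain ⟨k, hk⟩ := mem_Gamma0_iff_dvd.mp hg
  simp only [mem_Gamma0_iff_dvd, wMat_mul_apply_one_zero, mul_wMat_inv_apply_one_zero, ha, hd, hk]
  push_cast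
  rcases Int.even_or_odd' k with ⟨j, rfl | rfl⟩
  · exact .inl ⟨j, by ring⟩
  · exact .inr ⟨⟨j - d, by ring⟩, ⟨a + j + 1, by ring⟩⟩

/-- Conjugation adds `2m(a - d) - 4m²b` to the lower left entry, and `a - d` is even because `a` and
`d` are odd. -/
lemma wMat_conj_mem (m : ℕ) {g : SL(2, ℤ)} (hg : g ∈ Gamma0 (4 * m)) :
    wMat m * g * (wMat m)⁻¹ ∈ Gamma0 (4 * m) := by
  obtain ⟨⟨a, ha⟩, ⟨d, hd⟩⟩ := odd_of_mem_Gamma0 (Gamma0_four_le_two m hg)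
  obtain ⟨k, hk⟩ := mem_Gamma0_iff_dvd.mp hg
  rw [mem_Gamma0_iff_dvd, mul_wMat_inv_apply_one_zero, wMat_mul_apply_one_zero]
  have : (wMat m * g) 1 1 = 2 * m * g 0 1 + g 1 1 := by
    rw [Matrix.SpecialLinearGroup.coe_mul, coe_wMat]
    simp [Matrix.mul_apply]
  rw [this, ha, hd, hk]
  push_cast
  exact ⟨a - d + k - m * g 0 1, by ring⟩

/-! ### Petersson products and the trace to `Γ₀(2m)` -/

/-- The map `gH ↦ gw⁻¹H` permutes the cosets: the hypothesis on `w` makes it independent of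
representatives, and finiteness turns surjectivity into bijectivity. -/
lemma finsum_quotient_mul_inv {G A : Type*} [Group G] [AddCommMonoid A] {H : Subgroup G}
    [H.FiniteIndex] {w : G} (hw : ∀ g ∈ H, w * g * w⁻¹ ∈ H) {F : G → A}
    (hF : ∀ g, ∀ k ∈ H, F (g * k) = F g) :
    ∑ᶠ c : G ⧸ H, F (c.out * w⁻¹) = ∑ᶠ c : G ⧸ H, F c.out := by
  let e : G ⧸ H → G ⧸ H := fun c ↦ QuotientGroup.mk (c.out * w⁻¹)
  have hout (g : G) : F (QuotientGroup.mk g : G ⧸ H).out = F g := by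
    obtain ⟨k, hk⟩ := QuotientGroup.mk_out_eq_mul H g
    rw [hk, hF _ _ k.2]
  have hsurj : Function.Surjective e := by
    intro c
    induction c using QuotientGroup.induction_on with
    | H g =>
      refine ⟨QuotientGroup.mk (g * w), ?_⟩
      obtain ⟨k, hk⟩ := QuotientGroup.mk_out_eq_mul H (g * w)
      refine (QuotientGroup.eq.mpr ?_).symm
      rw [hk]
      convert hw _ k.2 using 1
      group
  have hbij : Function.Bijective e := ⟨Finite.injective_iff_surjective.mpr hsurj, hsurj⟩
  rw [← finsum_comp_equiv (Equiv.ofBijective e hbij) (f := fun c : G ⧸ H ↦ F c.out)]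
  exact finsum_congr fun c ↦ (hout _).symm

lemma petersson_self_eq (φ : ℍ → ℂ) (τ : ℍ) :
    petersson 2 φ φ τ = ((‖φ τ‖ ^ 2 * τ.im ^ 2 : ℝ) : ℂ) := by
  rw [petersson, ← Complex.normSq_eq_conj_mul_self, Complex.normSq_eq_norm_sq]
  push_cast
  rfl

/-- A holomorphic function whose Petersson square has vanishing integral over the fundamental
domain vanishes. -/
lemma eq_zero_of_setIntegral_petersson {φ : ℍ → ℂ} (hφ : MDiff φ)
    (hint : IntegrableOn (fun τ : ℍ ↦ ‖φ τ‖ ^ 2 * τ.im ^ 2) ModularGroup.fd)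
    (h : ∫ τ in ModularGroup.fd, ‖φ τ‖ ^ 2 * τ.im ^ 2 = 0) : φ = 0 := by
  rw [setIntegral_eq_zero_iff_of_nonneg_ae (.of_forall fun τ ↦ by positivity) hint] at h
  -- An open null set is empty, so `φ` vanishes on the interior of the fundamental domain, and the
  -- identity theorem applies.
  have hU : IsOpen (ModularGroup.fdo ∩ {τ | φ τ ≠ 0}) :=
    ModularGroup.isOpen_fdo.inter (isOpen_ne_fun hφ.continuous continuous_const)
  have hμ : volume (ModularGroup.fdo ∩ {τ | φ τ ≠ 0}) = 0 := by
    have h' := ae_iff.mp ((ae_restrict_iff' ModularGroup.isClosed_fd.measurableSet).mp h)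
    refine measure_mono_null (fun τ hτ ↦ ?_) h'
    have := τ.im_ne_zero
    simpa [ModularGroup.fdo_subset_fd hτ.1, this] using hτ.2
  have hempty := hU.measure_eq_zero_iff volume |>.mp hμ
  have hne : ModularGroup.fdo.Nonempty := by
    refine ⟨⟨2 * Complex.I, by simp⟩, ?_, ?_⟩
    · norm_num [Complex.normSq_apply]
    · simp [UpperHalfPlane.re]
  obtain ⟨τ, hτ⟩ := hne
  have hev : ∀ᶠ z in 𝓝 τ, φ z = 0 := by
    filter_upwards [ModularGroup.isOpen_fdo.mem_nhds hτ] with z hz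
    by_contra hz'
    exact (hempty ▸ (⟨hz, hz'⟩ : z ∈ ModularGroup.fdo ∩ {τ | φ τ ≠ 0}) : z ∈ (∅ : Set ℍ))
  exact eq_zero_of_frequently hφ (hev.filter_mono nhdsWithin_le_nhds).frequently

/-- A cusp form of level `4m` in the new subspace is anti-invariant under `τ ↦ τ / (2mτ + 1)`. -/
theorem slash_wMat_of_isNew {m : ℕ} (hm : 0 < m) (f : CuspForm (Gamma0 (4 * m)) 2)
    (hf : IsNew f) : (f : ℍ → ℂ) ∣[(2 : ℤ)] wMat m = -f := by
  have : NeZero (4 * m) := ⟨by omega⟩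
  have : NeZero (2 * m) := ⟨by omega⟩
  have : Fintype (SL(2, ℤ) ⧸ Gamma0 (4 * m)) := Fintype.ofFinite _
  set w := wMat m
  set φ : ℍ → ℂ := (f : ℍ → ℂ) + (f : ℍ → ℂ) ∣[(2 : ℤ)] w with hφ
  have hol : MDiff φ := (CuspFormClass.holo f).add ((CuspFormClass.holo f).slash 2 _)
  have hzero (g : SL(2, ℤ)) : IsZeroAtImInfty (φ ∣[(2 : ℤ)] g) := by
    rw [hφ, SlashAction.add_slash, ← SlashAction.slash_mul]
    simpa [IsZeroAtImInfty, ZeroAtFilter] using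
      (CuspFormClass.zero_at_infty_slash f g).add (CuspFormClass.zero_at_infty_slash f (w * g))
  -- Elements of `Γ₀(4m)` fix both summands of `φ`; those of the other coset exchange them.
  have hinv : ∀ g ∈ Gamma0 (2 * m), φ ∣[(2 : ℤ)] g = φ := by
    intro g hg
    rw [hφ, SlashAction.add_slash, ← SlashAction.slash_mul]
    rcases mem_Gamma0_four_or m hg with h | ⟨h1, h2⟩
    · rw [slash_eq_of_mem f h, show w * g = (w * g * w⁻¹) * w by group, SlashAction.slash_mul,
        slash_eq_of_mem f (wMat_conj_mem m h)]
    · rw [slash_eq_of_mem f h2, show g = (g * w⁻¹) * w by group, SlashAction.slash_mul,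
        slash_eq_of_mem f h1, add_comm]
  have hw : w ∈ Gamma0 (2 * m) := by
    rw [mem_Gamma0_iff_dvd]
    simp [w, wMat]
  let φ₂ : CuspForm (Gamma0 (2 * m)) 2 := cuspFormOfSlash _ φ hinv hol hzero
  let φ₄ : CuspForm (Gamma0 (4 * m)) 2 :=
    cuspFormOfSlash _ φ (fun g hg ↦ hinv g (Gamma0_four_le_two m hg)) hol hzero
  set Φ : ℍ → ℂ := petersson 2 f φ with hΦ
  have hΦcont : Continuous Φ := petersson_continuous 2 (CuspFormClass.holo f).continuous
    hol.continuous
  obtain ⟨C, hC⟩ : ∃ C, ∀ τ, ‖Φ τ‖ ≤ C := CuspFormClass.petersson_bounded_left 2 _ f φ₄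
  have hΦinv (g) (hg : g ∈ Gamma0 (4 * m)) (τ : ℍ) : Φ (g • τ) = Φ τ := by
    rw [hΦ, ← petersson_slash_SL, slash_eq_of_mem f hg, hinv g (Gamma0_four_le_two m hg)]
  have hΦint (g : SL(2, ℤ)) : IntegrableOn (fun τ : ℍ ↦ Φ (g • τ)) ModularGroup.fd := by
    have : IsFiniteMeasure (volume.restrict ModularGroup.fd) :=
      ⟨by simpa using volume_fd_lt_top⟩
    exact Integrable.of_bound (hΦcont.comp (continuous_const_smul (g : GL (Fin 2) ℝ))).aestronglyMeasurable C
      (.of_forall fun τ ↦ hC _)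
  -- Because `φ|w = φ`, the contribution of `f|w` paired with `φ` is `Φ` transported by `w`.
  have hsplit (τ : ℍ) : petersson 2 φ φ τ = Φ τ + Φ (w • τ) := by
    rw [hΦ, ← petersson_slash_SL, hinv w hw]
    simp only [petersson]
    conv_lhs => enter [1, 1]; rw [hφ]
    simp only [Pi.add_apply, map_add]
    ring
  have hortho : ∑ᶠ c : SL(2, ℤ) ⧸ Gamma0 (4 * m), ∫ τ in ModularGroup.fd, Φ (c.out⁻¹ • τ) = 0 := by
    have := hf (2 * m) 1 (by omega) ⟨2, by ring⟩ φ₂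
    have hd : dilate 1 φ₂ = φ := by
      funext τ
      simp [dilate, φ₂, coe_cuspFormOfSlash]
    rwa [hd] at this
  have hortho' : ∑ᶠ c : SL(2, ℤ) ⧸ Gamma0 (4 * m),
      ∫ τ in ModularGroup.fd, Φ ((w * c.out⁻¹) • τ) = 0 := by
    rw [← hortho]
    convert finsum_quotient_mul_inv (H := Gamma0 (4 * m)) (w := w)
      (F := fun g ↦ ∫ τ in ModularGroup.fd, Φ (g⁻¹ • τ)) (fun g hg ↦ wMat_conj_mem m hg) ?_
      using 4
    · simp
    · intro g k hk
      simp only [mul_inv_rev, mul_smul]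
      simp only [hΦinv _ (inv_mem hk)]
  have hsum : ∑ᶠ c : SL(2, ℤ) ⧸ Gamma0 (4 * m),
      ∫ τ in ModularGroup.fd, ‖φ (c.out⁻¹ • τ)‖ ^ 2 * (c.out⁻¹ • τ).im ^ 2 = 0 := by
    have key : ∑ᶠ c : SL(2, ℤ) ⧸ Gamma0 (4 * m),
        ∫ τ in ModularGroup.fd, petersson 2 φ φ (c.out⁻¹ • τ) = 0 := by
      rw [← add_zero (0 : ℂ)]
      nth_rewrite 1 [← hortho]
      rw [← hortho', ← finsum_add_distrib (Set.toFinite _) (Set.toFinite _)]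
      refine finsum_congr fun c ↦ ?_
      rw [← integral_add (hΦint _) (hΦint _)]
      simp only [hsplit, mul_smul]
    rw [finsum_eq_sum_of_fintype] at key ⊢
    simp only [petersson_self_eq] at key
    simp only [integral_complex_ofReal] at key
    exact_mod_cast key
  -- All terms are nonnegative, so each vanishes; one coset suffices, since a single translate of
  -- `φ` being zero forces `φ = 0`.
  rw [finsum_eq_sum_of_fintype, Finset.sum_eq_zero_iff_of_nonneg
    (fun c _ ↦ integral_nonneg fun τ ↦ by positivity)] at hsum
  obtain ⟨c⟩ : Nonempty (SL(2, ℤ) ⧸ Gamma0 (4 * m)) := inferInstance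
  have hc := hsum c (Finset.mem_univ _)
  have hslash (τ : ℍ) : ‖φ (c.out⁻¹ • τ)‖ ^ 2 * (c.out⁻¹ • τ).im ^ 2 =
      ‖(φ ∣[(2 : ℤ)] c.out⁻¹) τ‖ ^ 2 * τ.im ^ 2 := by
    have := petersson_slash_SL 2 φ φ c.out⁻¹ τ
    rw [petersson_self_eq, petersson_self_eq] at this
    exact_mod_cast this.symm
  have hint : IntegrableOn (fun τ : ℍ ↦ ‖φ (c.out⁻¹ • τ)‖ ^ 2 * (c.out⁻¹ • τ).im ^ 2)
      ModularGroup.fd := by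
    have := (hΦint c.out⁻¹).add (hΦint (w * c.out⁻¹))
    have h2 := this.re
    refine h2.congr (.of_forall fun τ ↦ ?_)
    simp only [Pi.add_apply, mul_smul]
    rw [← hsplit, petersson_self_eq]
    exact Complex.ofReal_re _
  simp only [hslash] at hc hint
  have h0 := eq_zero_of_setIntegral_petersson (hol.slash 2 _) hint hc
  have h1 : φ = 0 := by
    have := congrArg (fun ψ : ℍ → ℂ ↦ ψ ∣[(2 : ℤ)] c.out) h0
    change (φ ∣[(2 : ℤ)] (c.out⁻¹ : SL(2, ℤ))) ∣[(2 : ℤ)] c.out = 0 ∣[(2 : ℤ)] c.out at this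
    rwa [← SlashAction.slash_mul, inv_mul_cancel, SlashAction.slash_one,
      SlashAction.zero_slash] at this
  rw [hφ, add_comm] at h1
  exact eq_neg_of_add_eq_zero_left h1

/-! ### Primitives of cusp forms -/

/-- `G` is the primitive of `2πi f(z) dz` on the upper half-plane that vanishes at `i∞`. -/
structure IsPrimitiveAtInfty (f : ℍ → ℂ) (G : ℂ → ℂ) : Prop where
  hasDerivAt : ∀ τ : ℍ, HasDerivAt G (2 * Real.pi * Complex.I * f τ) τ
  tendsto : Tendsto (fun τ : ℍ ↦ G τ) atImInfty (𝓝 0)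

/-- With `q = exp(2πiτ/h)` one has `2πi f dτ = h (f/q) dq`. A cusp form vanishes at `q = 0`, so
`f/q` is holomorphic on the unit disc and has a primitive `P` there, normalised by `P(0) = 0`. -/
theorem exists_isPrimitiveAtInfty {k : ℤ} {Γ : Subgroup (GL (Fin 2) ℝ)} [Γ.IsArithmetic]
    (f : CuspForm Γ k) : ∃ G, IsPrimitiveAtInfty f G := by
  set h := Γ.strictWidthInfty
  have hh : 0 < h := Γ.strictWidthInfty_pos
  have hΓ : h ∈ Γ.strictPeriods := Γ.strictWidthInfty_mem_strictPeriods
  have hd : DifferentiableOn ℂ (dslope (cuspFunction h f) 0) (Metric.ball 0 1) := by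
    rw [Complex.differentiableOn_dslope (Metric.ball_mem_nhds _ one_pos)]
    exact fun q hq ↦ (ModularFormClass.differentiableAt_cuspFunction f hh hΓ
      (mem_ball_zero_iff.mp hq)).differentiableWithinAt
  obtain ⟨P, hP0, hP⟩ := hd.isExactOn_ball.with_val_at 0 0
  refine ⟨fun z ↦ h * P (Function.Periodic.qParam h z), fun τ ↦ ?_, ?_⟩
  · have hq : ‖Function.Periodic.qParam h τ‖ < 1 :=
      Function.Periodic.norm_qParam_lt_one hh τ.im_pos
    have hq' : HasDerivAt (Function.Periodic.qParam h)
        (Function.Periodic.qParam h τ * (2 * Real.pi * Complex.I / h)) τ := by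
      unfold Function.Periodic.qParam
      refine HasDerivAt.cexp ?_
      simpa using ((hasDerivAt_id (τ : ℂ)).const_mul (2 * Real.pi * Complex.I)).div_const (h : ℂ)
    refine (((hP _ (mem_ball_zero_iff.mpr hq)).comp _ hq').const_mul (h : ℂ)).congr_deriv ?_
    have hs := sub_smul_dslope (cuspFunction h f) 0 (Function.Periodic.qParam h τ)
    rw [CuspFormClass.cuspFunction_apply_zero f hh hΓ,
      SlashInvariantFormClass.eq_cuspFunction f τ hΓ hh.ne'] at hs
    simp only [sub_zero, smul_eq_mul] at hs
    have hhc : (h : ℂ) ≠ 0 := mod_cast hh.ne'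
    rw [← hs]
    field_simp
  · have hc : Tendsto P (𝓝 0) (𝓝 0) := by
      simpa [hP0] using (hP 0 (by simp)).continuousAt.tendsto
    simpa using (hc.comp (qParam_tendsto_atImInfty hh)).const_mul (h : ℂ)

lemma eqOn_const_of_hasDerivAt_zero {G : ℂ → ℂ} (hG : ∀ τ : ℍ, HasDerivAt G 0 τ) :
    ∃ K, ∀ τ : ℍ, G τ = K := by
  have hpre : IsPreconnected upperHalfPlaneSet := (convex_halfSpace_im_gt 0).isPreconnected
  obtain ⟨K, hK⟩ := isOpen_upperHalfPlaneSet.exists_is_const_of_deriv_eq_zero hpre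
    (f := G) (fun z hz ↦ (hG ⟨z, hz⟩).differentiableAt.differentiableWithinAt)
    (fun z hz ↦ (hG ⟨z, hz⟩).deriv)
  exact ⟨K, fun τ ↦ hK τ τ.im_pos⟩

/-- The derivative of `τ ↦ g • τ` is exactly the weight two automorphy factor. -/
lemma IsPrimitiveAtInfty.hasDerivAt_comp_smul {f : ℍ → ℂ} {G : ℂ → ℂ}
    (hG : IsPrimitiveAtInfty f G) (g : SL(2, ℤ)) (τ : ℍ) :
    HasDerivAt (fun z : ℂ ↦ G ↑(g • ofComplex z))
      (2 * Real.pi * Complex.I * (f ∣[(2 : ℤ)] g) τ) τ := by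
  have hdet : (g : GL (Fin 2) ℝ).val.det = 1 :=
    (Matrix.SpecialLinearGroup.map (Int.castRingHom ℝ) g).det_coe
  have h1 := (hasStrictDerivAt_smul (g := (g : GL (Fin 2) ℝ)) (hdet ▸ one_pos) τ).hasDerivAt
  have h2 : HasDerivAt G (2 * Real.pi * Complex.I * f (g • τ)) ↑(g • ofComplex (τ : ℂ)) := by
    rw [ofComplex_apply]
    exact hG.hasDerivAt (g • τ)
  refine (HasDerivAt.comp (τ : ℂ) (h := fun z : ℂ ↦ (↑(g • ofComplex z) : ℂ))
    h2 h1).congr_deriv ?_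
  rw [ModularForm.SL_slash_apply, hdet, zpow_neg, Complex.ofReal_one, one_div]
  norm_cast
  ring

/-! ### Vertical integrals -/

lemma tendsto_ofComplex_vertical (z : ℂ) :
    Tendsto (fun t : ℝ ↦ ofComplex (z + t * Complex.I)) atTop atImInfty := by
  refine tendsto_comap_im_ofComplex.comp (tendsto_comap_iff.mpr ?_)
  simpa [Function.comp_def] using tendsto_atTop_add_const_left atTop z.im tendsto_id

lemma continuousOn_vertical {f : ℍ → ℂ} (hf : MDiff f) {z : ℂ} (hz : 0 ≤ z.im) :
    ContinuousOn (fun t : ℝ ↦ f (ofComplex (z + t * Complex.I))) (Set.Ioi 0) := by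
  refine (UpperHalfPlane.mdifferentiable_iff.mp hf).continuousOn.comp
    (f := fun t : ℝ ↦ z + t * Complex.I) (by fun_prop) fun t ht ↦ ?_
  have : 0 < t := ht
  simpa using by positivity

lemma integrableOn_vertical {k : ℤ} {Γ : Subgroup (GL (Fin 2) ℝ)} [Γ.IsArithmetic]
    (f : CuspForm Γ k) {z b : ℂ} (hz : 0 ≤ z.im)
    (hb : Tendsto (fun t : ℝ ↦ f (ofComplex (z + t * Complex.I))) (𝓝[>] 0) (𝓝 b)) :
    IntegrableOn (fun t : ℝ ↦ f (ofComplex (z + t * Complex.I))) (Set.Ioi 0) := by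
  have hcont := continuousOn_vertical (CuspFormClass.holo f) hz
  rw [integrableOn_Ioi_iff_integrableAtFilter_atTop_nhdsWithin]
  refine ⟨?_, ?_, hcont.locallyIntegrableOn measurableSet_Ioi⟩
  · obtain ⟨c, hc, hO⟩ := CuspFormClass.exp_decay_atImInfty' f
    refine (hO.comp_tendsto (tendsto_ofComplex_vertical z)).integrableAtFilter
      ⟨Set.Ioi 0, Ioi_mem_atTop 0, hcont.aestronglyMeasurable measurableSet_Ioi⟩
      ⟨Set.Ioi 0, Ioi_mem_atTop 0, ?_⟩
    refine IntegrableOn.congr_fun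
      ((exp_neg_integrableOn_Ioi 0 hc).const_mul (Real.exp (-c * z.im))) (fun t ht ↦ ?_) measurableSet_Ioi
    have ht' : 0 < (z + t * Complex.I).im := by
      have : 0 < t := ht
      simpa using by positivity
    simp only [Function.comp_apply, ofComplex_apply_of_im_pos ht', ← Real.exp_add]
    congr 1
    simp [UpperHalfPlane.im]
    ring
  · exact hb.integrableAtFilter
      (hcont.stronglyMeasurableAtFilter_nhdsWithin measurableSet_Ioi _)
      (Measure.finiteAt_nhdsWithin _ _ _)

/-- The fundamental theorem of calculus on `(0, ∞)`. Allowing `z` to be real treats interior points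
and finite cusps together. -/
lemma verticalIntegral_eq_of_tendsto {k : ℤ} {Γ : Subgroup (GL (Fin 2) ℝ)} [Γ.IsArithmetic]
    (f : CuspForm Γ k) {G : ℂ → ℂ} (hG : IsPrimitiveAtInfty f G) {z b K : ℂ} (hz : 0 ≤ z.im)
    (hb : Tendsto (fun t : ℝ ↦ f (ofComplex (z + t * Complex.I))) (𝓝[>] 0) (𝓝 b))
    (hK : Tendsto (fun t : ℝ ↦ G (z + t * Complex.I)) (𝓝[>] 0) (𝓝 K)) :
    verticalIntegral f z = K := by
  have him {t : ℝ} (ht : 0 < t) : 0 < (z + t * Complex.I).im := by simpa using by positivity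
  have hint := ((integrableOn_vertical f hz hb).const_mul
    (2 * Real.pi * Complex.I)).mul_const Complex.I
  have hder (t : ℝ) (ht : t ∈ Set.Ioi 0) :
      -- For real `z` nothing is known about `G z` itself, so the value at `t = 0` is replaced by
      -- the limit `K`.
      HasDerivAt (Function.update (fun t : ℝ ↦ G (z + t * Complex.I)) 0 K)
        (2 * Real.pi * Complex.I * f (ofComplex (z + t * Complex.I)) * Complex.I) t := by
    have h1 := hG.hasDerivAt (ofComplex (z + t * Complex.I))
    rw [ofComplex_apply_of_im_pos (him ht)] at h1
    have h2 : HasDerivAt (fun t : ℝ ↦ z + t * Complex.I) Complex.I t := by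
      simpa using (Complex.ofRealCLM.hasDerivAt (x := t)).mul_const Complex.I |>.const_add z
    have h3 := HasDerivAt.comp t (h := fun t : ℝ ↦ z + t * Complex.I) h1 h2
    rw [ofComplex_apply_of_im_pos (him ht)]
    refine h3.congr_of_eventuallyEq ?_
    filter_upwards [isOpen_Ioi.mem_nhds ht] with s hs
    simp [Function.update_of_ne (ne_of_gt (Set.mem_Ioi.mp hs))]
  have hcont : ContinuousWithinAt (Function.update (fun t : ℝ ↦ G (z + t * Complex.I)) 0 K)
      (Set.Ici 0) 0 := by
    rwa [continuousWithinAt_update_same, Set.Ici_sdiff_left]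
  have htop : Tendsto (Function.update (fun t : ℝ ↦ G (z + t * Complex.I)) 0 K) atTop (𝓝 0) := by
    refine (hG.tendsto.comp (tendsto_ofComplex_vertical z)).congr' ?_
    filter_upwards [eventually_gt_atTop 0] with t ht
    simp [Function.update_of_ne (ne_of_gt ht), ofComplex_apply_of_im_pos (him ht)]
  rw [verticalIntegral, integral_Ioi_of_hasDerivAt_of_tendsto hcont hder hint htop]
  simp

lemma eichler_point {k : ℤ} {Γ : Subgroup (GL (Fin 2) ℝ)} [Γ.IsArithmetic]
    (f : CuspForm Γ k) {G : ℂ → ℂ} (hG : IsPrimitiveAtInfty f G) (τ : ℍ) :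
    eichler f (.point τ) = G τ := by
  have hline : Tendsto (fun t : ℝ ↦ (τ : ℂ) + t * Complex.I) (𝓝[>] 0) (𝓝 τ) := by
    have : Continuous (fun t : ℝ ↦ (τ : ℂ) + t * Complex.I) := by fun_prop
    simpa using (this.tendsto 0).mono_left nhdsWithin_le_nhds
  have hf : ContinuousAt ((f : ℍ → ℂ) ∘ ofComplex) τ :=
    (mdifferentiableAt_iff.mp (CuspFormClass.holo f τ)).continuousAt
  exact verticalIntegral_eq_of_tendsto f hG τ.im_pos.le (hf.tendsto.comp hline)
    ((hG.hasDerivAt τ).continuousAt.tendsto.comp hline)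

/-! ### Behaviour at the cusps -/

open Pointwise in
lemma isArithmetic_conj (Γ : Subgroup (GL (Fin 2) ℝ)) [Γ.IsArithmetic] (g : SL(2, ℤ)) :
    (ConjAct.toConjAct (g : GL (Fin 2) ℝ)⁻¹ • Γ).IsArithmetic := by
  simpa [(show Rat.castHom ℝ = algebraMap ℚ ℝ by rfl), map_inv,
    Matrix.SpecialLinearGroup.map_mapGL]
    using! Subgroup.IsArithmetic.conj Γ (Matrix.SpecialLinearGroup.mapGL ℚ g)⁻¹

/-- `G(gτ)` and the primitive of the cusp form `f|g` vanishing at `i∞` have the same derivative, so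
they differ by a constant, which is the limit. -/
lemma exists_tendsto_comp_smul {Γ : Subgroup (GL (Fin 2) ℝ)} [Γ.IsArithmetic]
    (f : CuspForm Γ 2) {G : ℂ → ℂ} (hG : IsPrimitiveAtInfty f G) (g : SL(2, ℤ)) :
    ∃ K, Tendsto (fun τ : ℍ ↦ G ↑(g • τ)) atImInfty (𝓝 K) := by
  have := isArithmetic_conj Γ g
  obtain ⟨P, hP⟩ := exists_isPrimitiveAtInfty (CuspForm.translate f (g : GL (Fin 2) ℝ))
  obtain ⟨K, hK⟩ := eqOn_const_of_hasDerivAt_zero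
    (G := fun z ↦ G ↑(g • ofComplex z) - P z) (fun τ ↦ by
      exact ((hG.hasDerivAt_comp_smul g τ).sub (hP.hasDerivAt τ)).congr_deriv (sub_self _))
  refine ⟨K, ?_⟩
  have := hP.tendsto.add_const K
  rw [zero_add] at this
  refine this.congr fun τ ↦ ?_
  rw [← hK τ, ofComplex_apply]
  ring

lemma tendsto_im_sq_mul {k : ℤ} {Γ : Subgroup (GL (Fin 2) ℝ)} [Γ.IsArithmetic]
    (f : CuspForm Γ k) : Tendsto (fun τ : ℍ ↦ (τ.im : ℂ) ^ 2 * f τ) atImInfty (𝓝 0) := by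
  obtain ⟨c, hc, hO⟩ := CuspFormClass.exp_decay_atImInfty' f
  have h1 : Tendsto (fun x : ℝ ↦ x ^ 2 * Real.exp (-c * x)) atTop (𝓝 0) := by
    have := (Real.tendsto_pow_mul_exp_neg_atTop_nhds_zero 2).comp
      (tendsto_id.const_mul_atTop hc)
    have := this.const_mul (c ^ 2)⁻¹
    rw [mul_zero] at this
    refine this.congr fun x ↦ ?_
    simp only [Function.comp_apply, id]
    field_simp
  have h2 : Tendsto (fun τ : ℍ ↦ τ.im ^ 2 * Real.exp (-c * τ.im)) atImInfty (𝓝 0) :=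
    h1.comp tendsto_comap
  refine Asymptotics.IsBigO.trans_tendsto (Asymptotics.IsBigO.mul ?_ hO) h2
  refine .of_norm_le fun τ ↦ ?_
  simp

lemma denom_inv_vertical {g : SL(2, ℤ)} (hg : g 1 0 ≠ 0) {t : ℝ} (ht : 0 < t) :
    denom (g⁻¹ : SL(2, ℤ)) (ofComplex (((g 0 0 / g 1 0 : ℚ) : ℂ) + t * Complex.I) : ℍ) =
      -(g 1 0 * t * Complex.I) := by
  have him : 0 < (((g 0 0 / g 1 0 : ℚ) : ℂ) + t * Complex.I).im := by simpa using ht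
  have hc : ((g 1 0 : ℤ) : ℂ) ≠ 0 := mod_cast hg
  rw [ModularGroup.denom_apply, ofComplex_apply_of_im_pos him,
    Matrix.SpecialLinearGroup.coe_inv, Matrix.adjugate_fin_two]
  push_cast
  simp
  field_simp
  ring

lemma im_inv_smul_vertical {g : SL(2, ℤ)} (hg : g 1 0 ≠ 0) {t : ℝ} (ht : 0 < t) :
    (g⁻¹ • (ofComplex (((g 0 0 / g 1 0 : ℚ) : ℂ) + t * Complex.I) : ℍ)).im =
      ((g 1 0 : ℝ) ^ 2 * t)⁻¹ := by
  have him : 0 < (((g 0 0 / g 1 0 : ℚ) : ℂ) + t * Complex.I).im := by simpa using ht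
  have hc : ((g 1 0 : ℤ) : ℝ) ≠ 0 := mod_cast hg
  rw [ModularGroup.im_smul_eq_div_normSq, denom_inv_vertical hg ht,
    ofComplex_apply_of_im_pos him]
  simp [UpperHalfPlane.im, Complex.normSq_apply]
  field_simp

lemma tendsto_inv_smul_vertical {g : SL(2, ℤ)} (hg : g 1 0 ≠ 0) :
    Tendsto (fun t : ℝ ↦ g⁻¹ • (ofComplex (((g 0 0 / g 1 0 : ℚ) : ℂ) + t * Complex.I) : ℍ))
      (𝓝[>] 0) atImInfty := by
  have hc : 0 < ((g 1 0 : ℤ) : ℝ) ^ 2 := by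
    have : ((g 1 0 : ℤ) : ℝ) ≠ 0 := mod_cast hg
    positivity
  refine tendsto_comap_iff.mpr ?_
  have h1 : Tendsto (fun t : ℝ ↦ (((g 1 0 : ℤ) : ℝ) ^ 2)⁻¹ * t⁻¹) (𝓝[>] 0) atTop :=
    tendsto_inv_nhdsGT_zero.const_mul_atTop (inv_pos.mpr hc)
  refine h1.congr' ?_
  filter_upwards [self_mem_nhdsWithin] with t ht
  rw [Function.comp_apply, im_inv_smul_vertical hg ht, mul_inv]

/-- Let `g` have first column `(a, c)`. For `σ = a/c + it` the point `g⁻¹σ` has height `y =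
1/(c²t)`, and `f(σ) = -c² y² (f|g)(g⁻¹σ)`. The decay of `f|g` at `i∞` beats the factor `y²`. -/
lemma tendsto_vertical_zero {Γ : Subgroup (GL (Fin 2) ℝ)} [Γ.IsArithmetic]
    (f : CuspForm Γ 2) {g : SL(2, ℤ)} (hg : g 1 0 ≠ 0) :
    Tendsto (fun t : ℝ ↦ f (ofComplex (((g 0 0 / g 1 0 : ℚ) : ℂ) + t * Complex.I)))
      (𝓝[>] 0) (𝓝 0) := by
  have := isArithmetic_conj Γ g
  have h1 := (tendsto_im_sq_mul (CuspForm.translate f (g : GL (Fin 2) ℝ))).comp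
    (tendsto_inv_smul_vertical hg)
  have h2 := h1.const_mul (-((g 1 0 : ℤ) : ℂ) ^ 2)
  rw [mul_zero] at h2
  refine h2.congr' ?_
  filter_upwards [self_mem_nhdsWithin] with t ht
  have ht0 : (t : ℂ) ≠ 0 := by
    have : t ≠ 0 := ne_of_gt ht
    exact_mod_cast this
  have hc : ((g 1 0 : ℤ) : ℂ) ≠ 0 := mod_cast hg
  set σ := ofComplex (((g 0 0 / g 1 0 : ℚ) : ℂ) + t * Complex.I) with hσ
  have hf : f σ = (((f : ℍ → ℂ) ∣[(2 : ℤ)] g) ∣[(2 : ℤ)] g⁻¹) σ := by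
    rw [← SlashAction.slash_mul, mul_inv_cancel, SlashAction.slash_one]
  rw [hf, ModularForm.SL_slash_apply, denom_inv_vertical hg ht, Function.comp_apply, ← hσ,
    im_inv_smul_vertical hg ht]
  change _ * (_ * ((f : ℍ → ℂ) ∣[(2 : ℤ)] g) (g⁻¹ • σ)) = _
  generalize ((f : ℍ → ℂ) ∣[(2 : ℤ)] g) (g⁻¹ • σ) = v
  push_cast
  rw [zpow_neg]
  norm_cast
  rw [neg_sq, mul_pow, Complex.I_sq]
  push_cast
  field_simp

/-- The Eichler integral of a cusp form extends continuously to the cusps. -/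
theorem tendsto_eichler_smul {Γ : Subgroup (GL (Fin 2) ℝ)} [Γ.IsArithmetic]
    (f : CuspForm Γ 2) (g : SL(2, ℤ)) :
    Tendsto (fun τ : ℍ ↦ eichler f (.point (g • τ))) atImInfty
      (𝓝 (eichler f (.cusp (Matrix.SpecialLinearGroup.mapGL ℚ g • OnePoint.infty)))) := by
  obtain ⟨G, hG⟩ := exists_isPrimitiveAtInfty f
  simp only [eichler_point f hG]
  rw [OnePoint.smul_infty_eq_ite]
  by_cases hg : g 1 0 = 0
  · rw [if_pos (by simp [hg])]
    exact hG.tendsto.comp (tendsto_smul_atImInfty (g := (g : GL (Fin 2) ℝ)) (by simp [hg]))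
  · rw [if_neg (by simpa using hg)]
    obtain ⟨K, hK⟩ := exists_tendsto_comp_smul f hG g
    convert hK
    -- The vertical path to the cusp is the image under `g` of a path tending to `i∞`, so `G` has
    -- the limit `K` along it.
    refine verticalIntegral_eq_of_tendsto f hG (by simp) (tendsto_vertical_zero f hg) ?_
    refine (hK.comp (tendsto_inv_smul_vertical hg)).congr' ?_
    filter_upwards [self_mem_nhdsWithin] with t ht
    have him : 0 < (((g 0 0 / g 1 0 : ℚ) : ℂ) + t * Complex.I).im := by
      simpa using (ht : 0 < t)
    simp only [Function.comp_apply, smul_inv_smul, ofComplex_apply_of_im_pos him]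
    rfl

/-- A cusp form of weight two that is anti-invariant under `g` has an Eichler integral that is
anti-invariant under `g` up to the constant `γ(g ∞)`. -/
theorem eichler_moebius_of_slash_eq_neg {Γ : Subgroup (GL (Fin 2) ℝ)} [Γ.IsArithmetic]
    (f : CuspForm Γ 2) {g : SL(2, ℤ)} (hf : (f : ℍ → ℂ) ∣[(2 : ℤ)] g = -f) (x : HStar) :
    eichler f (HStar.moebius g x) =
      eichler f (HStar.moebius g (.cusp OnePoint.infty)) - eichler f x := by
  obtain ⟨G, hG⟩ := exists_isPrimitiveAtInfty f
  obtain ⟨K, hK⟩ := eqOn_const_of_hasDerivAt_zero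
    (G := fun z ↦ G ↑(g • ofComplex z) + G z) (fun τ ↦ by
      refine ((hG.hasDerivAt_comp_smul g τ).add (hG.hasDerivAt τ)).congr_deriv ?_
      rw [hf]
      simp)
  have hpoint (τ : ℍ) : eichler f (.point (g • τ)) = K - eichler f (.point τ) := by
    rw [eichler_point f hG, eichler_point f hG, ← hK τ, ofComplex_apply]
    ring
  have hne : NeBot atImInfty := inferInstance
  have hcusp (h : SL(2, ℤ)) :
      eichler f (.cusp (Matrix.SpecialLinearGroup.mapGL ℚ (g * h) • OnePoint.infty)) =
        K - eichler f (.cusp (Matrix.SpecialLinearGroup.mapGL ℚ h • OnePoint.infty)) := by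
    refine tendsto_nhds_unique (tendsto_eichler_smul f (g * h)) ?_
    simp only [mul_smul, hpoint]
    exact (tendsto_eichler_smul f h).const_sub K
  -- The case `h = 1` identifies the constant, since `γ(i∞) = 0`.
  have hK' : eichler f (HStar.moebius g (.cusp OnePoint.infty)) = K := by
    have := hcusp 1
    rw [mul_one, map_one, one_smul] at this
    rw [HStar.moebius, this]
    exact sub_zero K
  rw [hK']
  cases x with
  | point τ => exact hpoint τ
  | cusp c =>
    -- `SL(2, ℤ)` acts transitively on the cusps.
    obtain ⟨h, rfl⟩ := OnePoint.exists_mem_SL2 ℤ c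
    rw [HStar.moebius, ← mul_smul, ← map_mul]
    exact hcusp h

/-- The function `x` takes the same value at points whose Eichler integrals are opposite modulo
the lattice. -/
lemma xCoord_eq_of_eichler_eq (W : WeierstrassCurve ℚ) (L : PeriodPair) {f : ℍ → ℂ} {x y : HStar}
    {l : ℂ} (hl : l ∈ L.lattice) (h : eichler f x = l - eichler f y) :
    xCoord W L f x = xCoord W L f y := by
  have hmem : eichler f x ∈ L.lattice ↔ eichler f y ∈ L.lattice := by
    rw [h]
    exact ⟨fun hx ↦ by simpa using sub_mem hl hx, sub_mem hl⟩
  have hP : L.weierstrassP (eichler f x) = L.weierstrassP (eichler f y) := by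
    have := L.weierstrassP_add_coe (-eichler f y) ⟨l, hl⟩
    rw [h, sub_eq_neg_add, this, L.weierstrassP_neg]
  unfold xCoord
  rw [hP]
  split_ifs with h1 h2 h2
  exacts [rfl, absurd (hmem.mp h1) h2, absurd (hmem.mpr h2) h1, rfl]

end ModularParam

end

theorem lemma8p2 (N m : ℕ) (hm : 0 < m) (hN : N = 4 * m)
    (W : WeierstrassCurve ℚ) [W.IsElliptic]
    (f : CuspForm (Gamma0 N) 2) (hf : ModularParam.IsNewform f)
    (hfW : ModularParam.IsAssociated f W)
    (L : PeriodPair) (hL : ModularParam.IsPeriodLattice W L)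
    (hopt : ModularParam.IsOptimal f L 1)
    (hcusp : ModularParam.eichler f (.cusp ((2 / N : ℚ) : OnePoint ℚ)) ∈ L.lattice)
    (τ : ModularParam.HStar) :
    ModularParam.xCoord W L f (ModularParam.HStar.moebius (ModularParam.wMat m) τ) =
      ModularParam.xCoord W L f τ := by
  subst hN
  have : NeZero (4 * m) := ⟨by omega⟩
  have hw := ModularParam.slash_wMat_of_isNew hm f hf.new
  have h2 : (2 / (4 * m : ℕ) : ℚ) = 1 / (2 * m) := by
    have : (m : ℚ) ≠ 0 := mod_cast hm.ne'
    push_cast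
    field_simp
    norm_num
  -- Since `2/N = 1/(2m) = w∞`, the hypothesis says that the constant `γ(w∞)` lies in `L`.
  rw [h2, ← ModularParam.wMat_smul_infty m hm.ne'] at hcusp
  exact ModularParam.xCoord_eq_of_eichler_eq W L hcusp
    (ModularParam.eichler_moebius_of_slash_eq_neg f hw τ)
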